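/- All graphs are finite and simple. The spectrum of a graph is the multiset of eigenvalues of its adjacency matrix (with multiplicities); two graphs are cospectral if they have the same spectrum, and a graph $G$ is determined by the spectrum (DS) if every graph cospectral with $G$ is isomorphic to $G$. For integers $p,q\ge 2$ let $K_{p,q}^-$ be the graph obtained from the complete bipartite graph $K_{p,q}$ by deleting one edge, and let $K_{p,q}^+$ be the graph obtained from $K_{p,q}$ by adding a new vertex $x$ and a new edge $xy$, where $y$ is a vertex in a partite set of order $\min\{p,q\}$. Let $mK_1$ denote $m$ isolated vertices and $\cup$ the disjoint union of graphs. **Theorem.** Let $3\le p\le q$ be integers. Then $K_{p,q}^+$ is not DS if and only if the quadratic polynomial $$x^2-(q+3)x+(pq+2)$$ has two integer roots $p''\le q''$ (counted with multiplicity), both at least $2$. Moreover, in that case, $K_{p'',q''}^-\cup(p-2)K_1$ is, up to isomorphism, the unique graph that is cospectral with $K_{p,q}^+$ and not isomorphic to it. -/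

import Mathlib

namespace NearlyCompleteBipartite

open scoped SimpleGraph

/-- The spectrum of a finite simple graph: the multiset of eigenvalues of its (real symmetric)
adjacency matrix, that is, the roots of the characteristic polynomial with multiplicity. -/
noncomputable def graphSpectrum {V : Type*} [Fintype V] (G : SimpleGraph V) : Multiset ℝ :=
  open Classical in (G.adjMatrix ℝ).charpoly.roots

/-- Two finite simple graphs are cospectral if they have the same spectrum. -/
def Cospectral {V W : Type*} [Fintype V] [Fintype W]
    (G : SimpleGraph V) (H : SimpleGraph W) : Prop :=
  graphSpectrum G = graphSpectrum H

/-- `G` is determined by the spectrum (DS): every finite simple graph cospectral with `G`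
is isomorphic to `G`. -/
def IsDS {V : Type*} [Fintype V] (G : SimpleGraph V) : Prop :=
  ∀ (W : Type) [Fintype W] (H : SimpleGraph W), Cospectral G H → Nonempty (G ≃g H)

/-- `K_{p,q}^-` (for `p, q ≥ 1`): the complete bipartite graph `K_{p,q}` with one edge deleted,
namely the edge joining the first vertices of the two partite sets. -/
def KMinus (p q : ℕ) : SimpleGraph (Fin p ⊕ Fin q) :=
  (completeBipartiteGraph (Fin p) (Fin q)).deleteEdges
    {e | ∃ (i : Fin p) (j : Fin q), i.val = 0 ∧ j.val = 0 ∧ e = s(Sum.inl i, Sum.inr j)}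

/-- The first vertex of a partite set of order `min p q` in `K_{p,q}`. -/
def IsAttachingVertex (p q : ℕ) : Fin p ⊕ Fin q → Prop
  | Sum.inl i => p ≤ q ∧ i.val = 0
  | Sum.inr j => q < p ∧ j.val = 0

/-- `K_{p,q}^+` (for `p, q ≥ 1`): the complete bipartite graph `K_{p,q}` together with a new
vertex `x = Sum.inr ()` and a new edge `xy`, where `y` lies in the partite set of order
`min p q`. -/
def KPlus (p q : ℕ) : SimpleGraph ((Fin p ⊕ Fin q) ⊕ Unit) :=
  (completeBipartiteGraph (Fin p) (Fin q) ⊕g (⊥ : SimpleGraph Unit)) ⊔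
    SimpleGraph.fromEdgeSet
      {e | ∃ y : Fin p ⊕ Fin q, IsAttachingVertex p q y ∧ e = s(Sum.inl y, Sum.inr ())}

/-- `G ∪ m K_1`: the disjoint union of `G` with `m` isolated vertices. -/
def addIsolated {V : Type*} (G : SimpleGraph V) (m : ℕ) : SimpleGraph (V ⊕ Fin m) :=
  G ⊕g (⊥ : SimpleGraph (Fin m))

/-- `H` is the unique non-isomorphic cospectral mate of `G`, up to isomorphism. -/
def IsUniqueCospectralMate {V W : Type*} [Fintype V] [Fintype W]
    (G : SimpleGraph V) (H : SimpleGraph W) : Prop :=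
  Cospectral G H ∧ IsEmpty (G ≃g H) ∧
    ∀ (U : Type) [Fintype U] (F : SimpleGraph U),
      Cospectral G F → IsEmpty (G ≃g F) → Nonempty (F ≃g H)

/-- The integers `a ≤ b` are the two roots, counted with multiplicity, of the polynomial
`x² - (q + 3) x + (p q + 2)`, and both are at least `2`. -/
def AreRootsGeTwo (p q a b : ℕ) : Prop :=
  2 ≤ a ∧ a ≤ b ∧
    (Polynomial.X ^ 2 - Polynomial.C ((q : ℤ) + 3) * Polynomial.X
      + Polynomial.C ((p : ℤ) * (q : ℤ) + 2)).roots = {(a : ℤ), (b : ℤ)}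

end NearlyCompleteBipartite

namespace NearlyCompleteBipartite

open Polynomial

/-! The spectrum fixes the order, the rank (the number of nonzero eigenvalues) and bipartiteness
(the vanishing of all odd power sums). `KPlus p q` is bipartite of rank less than 6, so every
cospectral graph is too. Such a graph is a blow-up, with empty classes allowed, of a path on five
vertices plus an isolated vertex (`exists_isBlowup`): three independent rows on one side would
already give rank 6.

The characteristic polynomial of a blow-up is a power of `X` times `X^4 - e X^2 + c`, up to
cancelling powers of `X`, with `e` and `c` explicit in the class sizes. Thus cospectrality of
blow-ups of equal order means equal `e` and `c`. For `KPlus p q` one has `e = pq + 1`, `c = q(p -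
1)`, so the gap `e - c = q + 1` is large. A large gap first empties an end class of the path,
leaving a path on four vertices, then makes one end class a single vertex, and finally makes another
class a single vertex. Two families remain (`IsBlowup.classify`): `KPlus p q` itself, and `KMinus a
b` with `p - 2` isolated vertices, where `a + b = q + 3` and `ab = pq + 2`. They are not isomorphic,
since `KPlus p q` has no isolated vertex. -/

/-- The adjacency matrix of the disjoint union of the path `2 - 0 - 4 - 1 - 3` and the isolated
vertex `5`. -/
def pathMatrix (R : Type*) [Zero R] [One R] : Matrix (Fin 6) (Fin 6) R :=
  !![0, 0, 1, 0, 1, 0;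
     0, 0, 0, 1, 1, 0;
     1, 0, 0, 0, 0, 0;
     0, 1, 0, 0, 0, 0;
     1, 1, 0, 0, 0, 0;
     0, 0, 0, 0, 0, 0]

/-- Adjacency in the disjoint union of the path `2 - 0 - 4 - 1 - 3` and the isolated
vertex `5`. -/
abbrev PathAdj (i j : Fin 6) : Prop := pathMatrix ℕ i j = 1

instance : DecidableRel PathAdj := fun i j => by unfold PathAdj; infer_instance

/-- `G` is obtained from the path `2 - 0 - 4 - 1 - 3` together with the isolated vertex `5` by
replacing each vertex `i` with an independent set of order `s i`. -/
def IsBlowup {V : Type*} [Fintype V] (G : SimpleGraph V) (s : Fin 6 → ℕ) : Prop :=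
  ∃ f : V → Fin 6, (∀ v w, G.Adj v w ↔ PathAdj (f v) (f w)) ∧
    ∀ i, Fintype.card {v // f v = i} = s i

/-! ### Blow-ups: isomorphism, characteristic polynomial, rank -/

section Blowup

variable {V W : Type*} [Fintype V] [Fintype W] {G : SimpleGraph V} {H : SimpleGraph W}
  {s : Fin 6 → ℕ}

theorem IsBlowup.nonempty_iso (hG : IsBlowup G s) (hH : IsBlowup H s) : Nonempty (G ≃g H) := by
  obtain ⟨f, hf, hfs⟩ := hG
  obtain ⟨g, hg, hgs⟩ := hH
  have key : ∀ i, Nonempty ({v // f v = i} ≃ {w // g w = i}) := fun i =>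
    Fintype.card_eq.mp ((hfs i).trans (hgs i).symm)
  let e := fun i => (key i).some
  let E : V ≃ W := (Equiv.sigmaFiberEquiv f).symm.trans
    ((Equiv.sigmaCongrRight e).trans (Equiv.sigmaFiberEquiv g))
  have hE : ∀ v, g (E v) = f v := fun v => (e (f v) ⟨v, rfl⟩).2
  exact ⟨⟨E, fun {a b} => by rw [hf, hg, hE, hE]⟩⟩

/-- Adjacency need only be preserved between nonempty classes, so a symmetry of a subpath can be
used once the remaining classes are empty. -/
theorem IsBlowup.relabel (hG : IsBlowup G s) (σ : Equiv.Perm (Fin 6))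
    (hσ : ∀ i j, s i ≠ 0 → s j ≠ 0 → (PathAdj i j ↔ PathAdj (σ i) (σ j))) :
    IsBlowup G (s ∘ σ.symm) := by
  obtain ⟨f, hf, hfs⟩ := hG
  have hs : ∀ v, s (f v) ≠ 0 := fun v => by
    rw [← hfs]
    exact (Fintype.card_pos_iff.mpr ⟨⟨v, rfl⟩⟩).ne'
  refine ⟨σ ∘ f, fun v w => (hf v w).trans (hσ _ _ (hs v) (hs w)), fun i => ?_⟩
  rw [Function.comp_apply, ← hfs]
  exact Fintype.card_congr (Equiv.subtypeEquivRight fun v => by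
    simp [Equiv.eq_symm_apply])

theorem IsBlowup.card_eq (hG : IsBlowup G s) :
    Fintype.card V = s 0 + s 1 + s 2 + s 3 + s 4 + s 5 := by
  obtain ⟨f, -, hfs⟩ := hG
  rw [← Fintype.card_congr (Equiv.sigmaFiberEquiv f), Fintype.card_sigma]
  simp [hfs, Fin.sum_univ_succ]
  ring

/-- The class indicator matrix of a labelling. -/
def labelMatrix (f : V → Fin 6) : Matrix V (Fin 6) ℝ :=
  Matrix.of fun v i => if f v = i then 1 else 0

theorem labelMatrix_transpose_mul_self (f : V → Fin 6) :
    (labelMatrix f).transpose * labelMatrix f =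
      Matrix.diagonal fun i => (Fintype.card {v // f v = i} : ℝ) := by
  ext i j
  simp only [Matrix.mul_apply, Matrix.transpose_apply, labelMatrix, Matrix.of_apply,
    Matrix.diagonal_apply, Fintype.card_subtype, mul_ite, mul_one, mul_zero]
  split_ifs with h
  · subst h
    rw [Finset.card_filter]
    push_cast
    exact Finset.sum_congr rfl fun v _ => by split_ifs <;> rfl
  · refine Finset.sum_eq_zero fun v _ => ?_
    split_ifs with h1 h2
    · exact absurd (h2.symm.trans h1) h
    all_goals rfl

omit [Fintype V] in
theorem adjMatrix_eq_labelMatrix [DecidableRel G.Adj] {f : V → Fin 6}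
    (hf : ∀ v w, G.Adj v w ↔ PathAdj (f v) (f w)) :
    G.adjMatrix ℝ = labelMatrix f * (pathMatrix ℝ * (labelMatrix f).transpose) := by
  have h01 : ∀ i j, (if PathAdj i j then (1 : ℝ) else 0) = pathMatrix ℝ i j := by
    intro i j
    fin_cases i <;> fin_cases j <;> simp [pathMatrix, PathAdj]
  ext v w
  simp only [SimpleGraph.adjMatrix_apply, hf, h01]
  simp [Matrix.mul_apply, labelMatrix]

theorem charpoly_pathMatrix_mul_diagonal (s : Fin 6 → ℝ) :
    (pathMatrix ℝ * Matrix.diagonal s).charpoly =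
      X ^ 2 * (X ^ 4 - C (s 0 * (s 2 + s 4) + s 1 * (s 3 + s 4)) * X ^ 2
        + C (s 0 * s 1 * (s 2 * s 3 + s 2 * s 4 + s 3 * s 4))) := by
  have : (pathMatrix ℝ * Matrix.diagonal s).charmatrix =
      !![X, 0, -C (s 2), 0, -C (s 4), 0;
         0, X, 0, -C (s 3), -C (s 4), 0;
         -C (s 0), 0, X, 0, 0, 0;
         0, -C (s 1), 0, X, 0, 0;
         -C (s 0), -C (s 1), 0, 0, X, 0;
         0, 0, 0, 0, 0, X] := by
    ext1 i j
    fin_cases i <;> fin_cases j <;>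
      simp [Matrix.mul_diagonal, -Matrix.cons_mul] <;> simp [pathMatrix]
  rw [Matrix.charpoly, this]
  simp [Matrix.det_succ_row_zero, Fin.sum_univ_succ, Fin.succAbove]
  ring

/-- For the label matrix `L`, the products `L (Q Lᵀ)` and `(Q Lᵀ) L` have the same characteristic
polynomial up to powers of `X`, and `Lᵀ L` is the diagonal of class sizes. Powers of `X` stay on
both sides because `V` may have fewer than six vertices. -/
theorem X_pow_mul_charpoly_labelMatrix [DecidableEq V] (f : V → Fin 6)
    (Q : Matrix (Fin 6) (Fin 6) ℝ) :
    X ^ 6 * (labelMatrix f * (Q * (labelMatrix f).transpose)).charpoly =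
      X ^ Fintype.card V *
        (Q * Matrix.diagonal fun i => (Fintype.card {v // f v = i} : ℝ)).charpoly := by
  have hd : Q * (labelMatrix f).transpose * labelMatrix f =
      Q * Matrix.diagonal fun i => (Fintype.card {v // f v = i} : ℝ) := by
    rw [Matrix.mul_assoc, labelMatrix_transpose_mul_self]
  have h := Matrix.charpoly_mul_comm' (labelMatrix f) (Q * (labelMatrix f).transpose)
  rw [Fintype.card_fin] at h
  exact h.trans (congrArg (fun M => X ^ Fintype.card V * Matrix.charpoly M) hd)

theorem IsBlowup.X_pow_mul_charpoly [DecidableEq V] [DecidableRel G.Adj] (hG : IsBlowup G s) :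
    X ^ 6 * (G.adjMatrix ℝ).charpoly = X ^ Fintype.card V *
      (X ^ 2 * (X ^ 4 - C ((s 0 * (s 2 + s 4) + s 1 * (s 3 + s 4) : ℕ) : ℝ) * X ^ 2
        + C ((s 0 * s 1 * (s 2 * s 3 + s 2 * s 4 + s 3 * s 4) : ℕ) : ℝ))) := by
  obtain ⟨f, hf, hfs⟩ := hG
  rw [adjMatrix_eq_labelMatrix hf, X_pow_mul_charpoly_labelMatrix,
    charpoly_pathMatrix_mul_diagonal]
  simp only [hfs]
  push_cast
  rfl

theorem rank_pathMatrix_lt : (pathMatrix ℝ).rank < 6 := by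
  refine lt_of_le_of_ne (Matrix.rank_le_width _) fun h => ?_
  have h5 : (pathMatrix ℝ) 5 = 0 := by ext j; fin_cases j <;> simp [pathMatrix]
  rw [Matrix.rank_eq_finrank_span_row] at h
  have hl : LinearIndependent ℝ (pathMatrix ℝ).row := by
    rw [linearIndependent_iff_card_eq_finrank_span]
    simpa [Set.finrank] using h.symm
  exact hl.ne_zero 5 h5

theorem IsBlowup.rank_lt [DecidableRel G.Adj] (hG : IsBlowup G s) :
    (G.adjMatrix ℝ).rank < 6 := by
  obtain ⟨f, hf, -⟩ := hG
  rw [adjMatrix_eq_labelMatrix hf]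
  exact ((Matrix.rank_mul_le_right _ _).trans (Matrix.rank_mul_le_left _ _)).trans_lt
    rank_pathMatrix_lt

theorem IsBlowup.colorable (hG : IsBlowup G s) : G.Colorable 2 := by
  obtain ⟨f, hf, -⟩ := hG
  have key : ∀ i j, PathAdj i j → (![0, 0, 1, 1, 1, 0] : Fin 6 → Fin 2) i ≠ ![0, 0, 1, 1, 1, 0] j := by
    decide
  exact ⟨SimpleGraph.Coloring.mk (fun v => ![0, 0, 1, 1, 1, 0] (f v))
    fun {v w} h => key _ _ ((hf v w).mp h)⟩

end Blowup

/-! ### Order, rank and bipartiteness from the spectrum -/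

section Spectrum

variable {V W : Type*} [Fintype V] [Fintype W] {G : SimpleGraph V} {H : SimpleGraph W}

omit [Fintype V] in
theorem isHermitian_adjMatrix (G : SimpleGraph V) [DecidableRel G.Adj] :
    (G.adjMatrix ℝ).IsHermitian := by
  rw [Matrix.IsHermitian, Matrix.conjTranspose_eq_transpose_of_trivial]
  exact G.isSymm_adjMatrix

theorem trace_pow_eq_sum_roots [DecidableEq V] {A : Matrix V V ℝ} (hA : A.IsHermitian) (k : ℕ) :
    (A ^ k).trace = (A.charpoly.roots.map (· ^ k)).sum := by
  rw [hA.roots_charpoly_eq_eigenvalues]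
  conv_lhs => rw [hA.spectral_theorem, ← map_pow, Unitary.conjStarAlgAut_apply,
    Matrix.trace_mul_cycle, Unitary.coe_star_mul_self, one_mul, Matrix.diagonal_pow,
    Matrix.trace_diagonal]
  simp

theorem rank_eq_card_roots_ne_zero [DecidableEq V] {A : Matrix V V ℝ} (hA : A.IsHermitian) :
    A.rank = (A.charpoly.roots.filter (· ≠ 0)).card := by
  rw [hA.rank_eq_card_non_zero_eigs, hA.roots_charpoly_eq_eigenvalues, Multiset.filter_map,
    Multiset.card_map, Fintype.card_subtype]
  simp [Finset.card_def]

theorem Cospectral.charpoly_eq [DecidableEq V] [DecidableEq W] [DecidableRel G.Adj]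
    [DecidableRel H.Adj] (h : Cospectral G H) :
    (G.adjMatrix ℝ).charpoly = (H.adjMatrix ℝ).charpoly := by
  have h' : (G.adjMatrix ℝ).charpoly.roots = (H.adjMatrix ℝ).charpoly.roots := by
    unfold Cospectral graphSpectrum at h
    convert h
  rw [(isHermitian_adjMatrix G).splits_charpoly.eq_prod_roots_of_monic (Matrix.charpoly_monic _),
    (isHermitian_adjMatrix H).splits_charpoly.eq_prod_roots_of_monic (Matrix.charpoly_monic _), h']

theorem cospectral_of_charpoly_eq [DecidableEq V] [DecidableEq W] [DecidableRel G.Adj]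
    [DecidableRel H.Adj] (h : (G.adjMatrix ℝ).charpoly = (H.adjMatrix ℝ).charpoly) :
    Cospectral G H := by
  unfold Cospectral graphSpectrum
  convert congrArg Polynomial.roots h

theorem Cospectral.card_eq (h : Cospectral G H) : Fintype.card V = Fintype.card W := by
  classical
  have := congrArg natDegree h.charpoly_eq
  simpa [Matrix.charpoly_natDegree_eq_dim] using this

theorem Cospectral.rank_eq [DecidableRel G.Adj] [DecidableRel H.Adj] (h : Cospectral G H) :
    (G.adjMatrix ℝ).rank = (H.adjMatrix ℝ).rank := by
  classical
  rw [rank_eq_card_roots_ne_zero (isHermitian_adjMatrix G),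
    rank_eq_card_roots_ne_zero (isHermitian_adjMatrix H), h.charpoly_eq]

theorem Cospectral.trace_pow_eq [DecidableEq V] [DecidableEq W] [DecidableRel G.Adj]
    [DecidableRel H.Adj] (h : Cospectral G H) (k : ℕ) :
    (G.adjMatrix ℝ ^ k).trace = (H.adjMatrix ℝ ^ k).trace := by
  rw [trace_pow_eq_sum_roots (isHermitian_adjMatrix G),
    trace_pow_eq_sum_roots (isHermitian_adjMatrix H), h.charpoly_eq]

/-- The trace of the `k`-th power counts closed walks of length `k`, so it vanishes only if there
are none. -/
theorem colorable_two_iff_trace [DecidableEq V] [DecidableRel G.Adj] :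
    G.Colorable 2 ↔ ∀ k, Odd k → (G.adjMatrix ℝ ^ k).trace = 0 := by
  rw [SimpleGraph.two_colorable_iff_forall_loop_even]
  simp only [Matrix.trace, Matrix.diag_apply, SimpleGraph.adjMatrix_pow_apply_eq_card_walk]
  constructor
  · intro h k hk
    refine Finset.sum_eq_zero fun v _ => ?_
    rw [Nat.cast_eq_zero, Fintype.card_eq_zero_iff]
    exact ⟨fun w => (Nat.not_even_iff_odd.mpr hk) (w.2 ▸ h v w.1)⟩
  · intro h v w
    by_contra hw
    have := h _ (Nat.not_even_iff_odd.mp hw)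
    rw [Finset.sum_eq_zero_iff_of_nonneg fun _ _ => Nat.cast_nonneg _] at this
    have := this v (Finset.mem_univ v)
    rw [Nat.cast_eq_zero, Fintype.card_eq_zero_iff] at this
    exact this.elim ⟨w, rfl⟩

theorem Cospectral.colorable_two (h : Cospectral G H) (hG : G.Colorable 2) : H.Colorable 2 := by
  classical
  rw [colorable_two_iff_trace] at hG ⊢
  intro k hk
  rw [← h.trace_pow_eq, hG k hk]

end Spectrum

/-! ### Bipartite graphs of rank less than six -/

section Classification

variable {V : Type*} [Fintype V] {G : SimpleGraph V}

/-- A family of linearly independent rows of a matrix contains an invertible square submatrix. -/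
theorem exists_isUnit_submatrix {K m n : Type*} [Field K] [Finite m] [Fintype n]
    {A : Matrix m n K} {d : ℕ} {u : Fin d → m} (h : LinearIndependent K fun k => A (u k)) :
    ∃ w : Fin d → n, IsUnit (A.submatrix u w) := by
  have h3 : (A.submatrix u id).rank = d := by
    have : LinearIndependent K (A.submatrix u id).row := h
    simpa using this.rank_matrix
  have hex := Submodule.exists_fun_fin_finrank_span_eq K (Set.range (A.submatrix u id).col)
  rw [← Matrix.rank_eq_finrank_span_cols, h3] at hex
  obtain ⟨g, hg, -, hli⟩ := hex
  choose w hw using hg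
  refine ⟨w, Matrix.linearIndependent_cols_iff_isUnit.mp ?_⟩
  have hg : (A.submatrix u w).col = g := by
    funext k
    rw [← hw]
    rfl
  rwa [hg]

theorem isUnit_fromBlocks_zero_transpose {K n : Type*} [Field K] [Fintype n] [DecidableEq n]
    {D : Matrix n n K} (hD : IsUnit D) : IsUnit (Matrix.fromBlocks 0 D D.transpose 0) := by
  have hT : IsUnit D.transpose := (Matrix.isUnit_transpose D).mpr hD
  rw [Matrix.isUnit_iff_isUnit_det] at hD hT
  refine IsUnit.of_mul_eq_one (Matrix.fromBlocks 0 (D.transpose)⁻¹ D⁻¹ 0) ?_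
  rw [Matrix.fromBlocks_multiply]
  simp [Matrix.mul_nonsing_inv _ hD, Matrix.mul_nonsing_inv _ hT]

/-- Independent rows give an invertible 3 × 3 submatrix `D`. Its columns lie on the other side, as a
column from the same side would be zero, so `D` and its transpose form an invertible 6 × 6
submatrix. -/
theorem not_linearIndependent_of_rank_lt [DecidableRel G.Adj] (c : G.Coloring (Fin 2))
    (hr : (G.adjMatrix ℝ).rank < 6) (i : Fin 2) (u : Fin 3 → V) (hu : ∀ k, c (u k) = i) :
    ¬ LinearIndependent ℝ fun k => G.adjMatrix ℝ (u k) := by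
  intro h
  obtain ⟨w, hw⟩ := exists_isUnit_submatrix h
  have hcw : ∀ k, c (w k) ≠ i := by
    intro k hk
    have hcol := (Matrix.linearIndependent_cols_iff_isUnit.mpr hw).ne_zero k
    apply hcol
    ext j
    simp only [Matrix.col_apply, Matrix.submatrix_apply, SimpleGraph.adjMatrix_apply, Pi.zero_apply]
    exact if_neg fun hadj => c.valid hadj ((hu j).trans hk.symm)
  have hww : ∀ k l, ¬ G.Adj (w k) (w l) := fun k l hadj => by
    have h1 := hcw k
    have h2 := hcw l
    have h3 := c.valid hadj
    omega
  have hblock : (G.adjMatrix ℝ).submatrix (Sum.elim u w) (Sum.elim u w) =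
      Matrix.fromBlocks 0 ((G.adjMatrix ℝ).submatrix u w)
        ((G.adjMatrix ℝ).submatrix u w).transpose 0 := by
    ext a b
    rcases a with a | a <;> rcases b with b | b
    · simpa using fun hadj => c.valid hadj ((hu a).trans (hu b).symm)
    · simp
    · simp [G.adj_comm]
    · simpa using hww a b
  have hle := Matrix.rank_submatrix_le (G.adjMatrix ℝ) (Sum.elim u w) (Sum.elim u w)
  rw [hblock, Matrix.rank_of_isUnit _ (isUnit_fromBlocks_zero_transpose hw)] at hle
  simp at hle
  omega

/-- A linear relation between three vertices on the same side of a bipartite graph whose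
adjacency matrix has rank less than six. -/
theorem exists_relation [DecidableRel G.Adj] (c : G.Coloring (Fin 2))
    (hr : (G.adjMatrix ℝ).rank < 6) {i : Fin 2} {u v w : V} (hu : c u = i) (hv : c v = i)
    (hw : c w = i) : ∃ α β γ : ℝ, (α ≠ 0 ∨ β ≠ 0 ∨ γ ≠ 0) ∧ ∀ x,
      (if G.Adj u x then α else 0) + (if G.Adj v x then β else 0)
        + (if G.Adj w x then γ else 0) = 0 := by
  have h := not_linearIndependent_of_rank_lt c hr i ![u, v, w]
    (by intro k; fin_cases k <;> assumption)
  obtain ⟨g, hg, k, hk⟩ := Fintype.not_linearIndependent_iff.mp h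
  refine ⟨g 0, g 1, g 2, ?_, fun x => ?_⟩
  · fin_cases k
    exacts [Or.inl hk, Or.inr (Or.inl hk), Or.inr (Or.inr hk)]
  · have := congrFun hg x
    simp [Fin.sum_univ_three, SimpleGraph.adjMatrix_apply] at this
    exact this

-- Indicators of two distinct nonempty sets are independent, so all three coefficients are nonzero
-- and no point lies in exactly one set.
open Classical in
theorem exists_disjoint_of_relation {X : Type*} {a b c : X → Prop} (ha : ∃ x, a x)
    (hb : ∃ x, b x) (hc : ∃ x, c x) (hab : a ≠ b) (hac : a ≠ c) (hbc : b ≠ c) {α β γ : ℝ}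
    (h0 : α ≠ 0 ∨ β ≠ 0 ∨ γ ≠ 0)
    (h : ∀ x, (if a x then α else 0) + (if b x then β else 0) + (if c x then γ else 0) = 0) :
    (∀ x, ¬ (a x ∧ b x)) ∨ (∀ x, ¬ (a x ∧ c x)) ∨ (∀ x, ¬ (b x ∧ c x)) := by
  have pair : ∀ {a b : X → Prop} {α β : ℝ}, (∃ x, a x) → (∃ x, b x) → a ≠ b →
      (∀ x, (if a x then α else 0) + (if b x then β else 0) = 0) → α = 0 ∧ β = 0 := by
    intro a b α β ⟨x, hx⟩ ⟨y, hy⟩ hne h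
    obtain ⟨z, hz⟩ : ∃ z, ¬ (a z ↔ b z) := by
      by_contra! hcon
      exact hne (funext fun z => propext (hcon z))
    have h1 := h x
    have h2 := h y
    have h3 := h z
    grind
  have hα : α ≠ 0 := by
    rintro rfl
    have := pair hb hc hbc (by simpa using h)
    grind
  have hβ : β ≠ 0 := by
    rintro rfl
    have := pair ha hc hac (by simpa using h)
    grind
  have hγ : γ ≠ 0 := by
    rintro rfl
    have := pair ha hb hab (by simpa using h)
    grind
  by_contra! hcon
  obtain ⟨⟨x, hax, hbx⟩, ⟨y, hay, hcy⟩, ⟨z, hbz, hcz⟩⟩ := hcon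
  -- If the sum is zero, no point lies in exactly two sets, so the sets coincide. Otherwise no point
  -- lies in all three, and the common points of the pairs make all pairwise sums vanish.
  by_cases hs : α + β + γ = 0
  · refine hab (funext fun t => propext ?_)
    have := h t
    grind
  · have h1 := h x
    have h2 := h y
    have h3 := h z
    have k1 : α + β = 0 := by grind
    have k2 : α + γ = 0 := by grind
    have k3 : β + γ = 0 := by grind
    exact hα (by linarith)

theorem exists_isBlowup_of_two_types (c : G.Coloring (Fin 2)) (i : Fin 2) (a b : V → Prop)
    (h : ∀ u, c u = i → (∀ w, ¬ G.Adj u w) ∨ G.Adj u = a ∨ G.Adj u = b) :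
    ∃ s, IsBlowup G s := by
  classical
  -- On side `i` the neighbourhood decides the class; on the other side, membership in `a` and `b`
  -- does, with the middle class `4` for both. Isolated vertices get `5`.
  refine ⟨_, fun v => if c v = i then
      (if ∀ w, ¬ G.Adj v w then 5 else if G.Adj v = a then 0 else 1)
    else (if a v then (if b v then 4 else 2) else (if b v then 3 else 5)), ?_, fun _ => rfl⟩
  have key : ∀ u w, c u = i → c w ≠ i → (G.Adj u w ↔ PathAdj
      (if ∀ w, ¬ G.Adj u w then 5 else if G.Adj u = a then 0 else 1)
      (if a w then (if b w then 4 else 2) else (if b w then 3 else 5))) := by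
    intro u w hu hw
    by_cases h1 : ∀ w, ¬ G.Adj u w
    · rw [if_pos h1]
      refine iff_of_false (h1 w) ?_
      split_ifs <;> decide
    · rw [if_neg h1]
      by_cases h2 : G.Adj u = a
      · rw [if_pos h2, h2]
        split_ifs with h3 h4 <;> simp only [h3, true_iff, false_iff] <;> decide
      · rw [if_neg h2, ((h u hu).resolve_left h1).resolve_left h2]
        split_ifs with h3 h4 h4 <;> simp only [h4, true_iff, false_iff] <;> decide
  have symm : ∀ j k, PathAdj j k ↔ PathAdj k j := by decide
  intro v w
  by_cases hv : c v = i <;> by_cases hw : c w = i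
  · simp only [if_pos hv, if_pos hw]
    refine iff_of_false (fun hadj => c.valid hadj (hv.trans hw.symm)) ?_
    split_ifs <;> decide
  · simpa only [if_pos hv, if_neg hw] using key v w hv hw
  · rw [G.adj_comm, symm]
    simpa only [if_pos hw, if_neg hv] using key w v hw hv
  · simp only [if_neg hv, if_neg hw]
    refine iff_of_false (fun hadj => ?_) ?_
    · have := c.valid hadj
      omega
    · split_ifs <;> decide

/-- Every row on side `i` is a combination of those of `v` and `w`, so each neighbourhood there is a
union of some of the two disjoint ones. Hence the opposite side has at most two nonempty
neighbourhood types, those of `x` and `y`. -/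
theorem exists_isBlowup_of_disjoint [DecidableRel G.Adj] (c : G.Coloring (Fin 2))
    (hr : (G.adjMatrix ℝ).rank < 6) {i : Fin 2} {v w : V} (hv : c v = i) (hw : c w = i)
    (hv0 : ∃ x, G.Adj v x) (hw0 : ∃ x, G.Adj w x) (hd : ∀ x, ¬ (G.Adj v x ∧ G.Adj w x)) :
    ∃ s, IsBlowup G s := by
  obtain ⟨x, hx⟩ := hv0
  obtain ⟨y, hy⟩ := hw0
  have hxw : ¬ G.Adj w x := fun h => hd x ⟨hx, h⟩
  have hyv : ¬ G.Adj v y := fun h => hd y ⟨h, hy⟩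
  have hside : ∀ t, G.Adj v t ∨ G.Adj w t → ∀ u, G.Adj u t → c u = i := by
    intro t ht u hu
    have h1 := c.valid hu
    rcases ht with ht | ht
    all_goals
      have h2 := c.valid ht
      omega
  have key : ∀ u, c u = i → (∀ t, G.Adj v t → (G.Adj u t ↔ G.Adj u x)) ∧
      (∀ t, G.Adj w t → (G.Adj u t ↔ G.Adj u y)) ∧
      (∀ t, ¬ G.Adj v t → ¬ G.Adj w t → ¬ G.Adj u t) := by
    intro u hu
    obtain ⟨α, β, γ, h0, h⟩ := exists_relation c hr hu hv hw
    have h1 := h x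
    have h2 := h y
    simp only [hx, hy, hxw, hyv, if_true, if_false, add_zero] at h1 h2
    have hα : α ≠ 0 := by
      rintro rfl
      simp at h1 h2
      grind
    refine ⟨fun t ht => ?_, fun t ht => ?_, fun t ht ht' hut => ?_⟩
    · have h3 := h t
      have := hd t
      grind
    · have h3 := h t
      have := hd t
      grind
    · have h3 := h t
      simp [ht, ht', hut, hα] at h3
  refine exists_isBlowup_of_two_types c (1 - i) (G.Adj x) (G.Adj y) fun t ht => ?_
  have hno : ∀ {t}, c t = 1 - i → ∀ u, G.Adj t u → c u = i := fun {t} ht u hu => by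
    have := c.valid hu
    omega
  by_cases hvt : G.Adj v t
  · right; left
    funext u
    refine propext ⟨fun h => ?_, fun h => ?_⟩
    · exact ((key u (hside t (Or.inl hvt) u h.symm)).1 t hvt |>.mp h.symm).symm
    · exact ((key u (hside x (Or.inl hx) u h.symm)).1 t hvt |>.mpr h.symm).symm
  · by_cases hwt : G.Adj w t
    · right; right
      funext u
      refine propext ⟨fun h => ?_, fun h => ?_⟩
      · exact ((key u (hside t (Or.inr hwt) u h.symm)).2.1 t hwt |>.mp h.symm).symm
      · exact ((key u (hside y (Or.inr hy) u h.symm)).2.1 t hwt |>.mpr h.symm).symm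
    · left
      intro u hu
      exact (key u (hno ht u hu)).2.2 t hvt hwt hu.symm

/-- A bipartite graph whose adjacency matrix has rank less than six is a blow-up of the
disjoint union of a path on five vertices and an isolated vertex. -/
theorem exists_isBlowup [DecidableRel G.Adj] (hc : G.Colorable 2)
    (hr : (G.adjMatrix ℝ).rank < 6) : ∃ s, IsBlowup G s := by
  obtain ⟨c⟩ := hc
  by_cases htwo : ∃ a b : V → Prop,
      ∀ u, c u = 0 → (∀ w, ¬ G.Adj u w) ∨ G.Adj u = a ∨ G.Adj u = b
  · obtain ⟨a, b, h⟩ := htwo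
    exact exists_isBlowup_of_two_types c 0 a b h
  push Not at htwo
  -- Side `0` has three distinct nonempty neighbourhoods, picked greedily.
  obtain ⟨u, hu, hu0, -, -⟩ := htwo (fun _ => False) (fun _ => False)
  obtain ⟨v, hv, hv0, hvu, -⟩ := htwo (G.Adj u) (G.Adj u)
  obtain ⟨w, hw, hw0, hwu, hwv⟩ := htwo (G.Adj u) (G.Adj v)
  obtain ⟨α, β, γ, h0, h⟩ := exists_relation c hr hu hv hw
  rcases exists_disjoint_of_relation hu0 hv0 hw0 hvu.symm hwu.symm hwv.symm h0
    (by intro x; convert h x) with hd | hd | hd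
  · exact exists_isBlowup_of_disjoint c hr hu hv hu0 hv0 hd
  · exact exists_isBlowup_of_disjoint c hr hu hw hu0 hw0 hd
  · exact exists_isBlowup_of_disjoint c hr hv hw hv0 hw0 hd

end Classification

open Polynomial

/-! ### Inequalities for class sizes, and Vieta's formulas -/

section Arithmetic

/-- The characteristic polynomial of a blow-up of a path on five vertices takes a value of at least
`0` at `1` if both end classes are nonempty. -/
theorem eq_zero_or_eq_zero_of_lt {m n x y z : ℕ} (hm : 1 ≤ m) (hn : 1 ≤ n)
    (h : m * n * (x * y + x * z + y * z) + 1 < m * (x + z) + n * (y + z)) : x = 0 ∨ y = 0 := by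
  by_contra! hcon
  -- With `mx = s + 1` and `ny = t + 1`, the value at `1` is `st + z(ns + mt)`.
  obtain ⟨s, hs⟩ : ∃ s, m * x = s + 1 := Nat.exists_eq_succ_of_ne_zero (by
    have := hcon.1; positivity)
  obtain ⟨t, ht⟩ : ∃ t, n * y = t + 1 := Nat.exists_eq_succ_of_ne_zero (by
    have := hcon.2; positivity)
  have h1 : m * n * (x * y + x * z + y * z) =
      (m * x) * (n * y) + z * (n * (m * x) + m * (n * y)) := by ring
  have h2 : m * (x + z) + n * (y + z) = m * x + n * y + z * (m + n) := by ring
  rw [h1, h2, hs, ht] at h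
  nlinarith [Nat.zero_le (s * t), Nat.zero_le (z * (n * s)), Nat.zero_le (z * (m * t))]

/-- Here `x` and `n` are the end classes of the four-vertex path. The bound is sharp: `m = z = 1`,
`n = x = 2` gives equality. -/
theorem eq_one_or_eq_one_of_lt {m n x z : ℕ} (hm : 1 ≤ m) (hn : 1 ≤ n) (hx : 1 ≤ x) (hz : 1 ≤ z)
    (h : m * n * (x * z) + 1 < m * (x + z) + n * z) : n = 1 ∨ x = 1 := by
  by_contra! hcon
  obtain ⟨n, rfl⟩ : ∃ k, n = k + 2 := Nat.exists_eq_add_of_le' (by omega)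
  obtain ⟨x, rfl⟩ : ∃ k, x = k + 2 := Nat.exists_eq_add_of_le' (by omega)
  obtain ⟨m, rfl⟩ : ∃ k, m = k + 1 := Nat.exists_eq_add_of_le' hm
  obtain ⟨z, rfl⟩ : ∃ k, z = k + 1 := Nat.exists_eq_add_of_le' hz
  ring_nf at h
  nlinarith [Nat.zero_le (m * n), Nat.zero_le (m * z), Nat.zero_le (m * x), Nat.zero_le (z * n),
    Nat.zero_le (z * x), Nat.zero_le (n * x), Nat.zero_le (m * n * x), Nat.zero_le (m * n * z),
    Nat.zero_le (m * x * z), Nat.zero_le (n * x * z), Nat.zero_le (m * n * x * z)]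

/-- This is the case `n = 1`. The gap must exceed 2, since `x = z = 2` gives exactly 2 for every
`m`. -/
theorem eq_one_or_eq_one_of_two_lt {m x z : ℕ} (hm : 1 ≤ m) (hx : 1 ≤ x) (hz : 1 ≤ z)
    (h : m * (x * z) + 2 < m * (x + z) + z) : z = 1 ∨ x = 1 := by
  by_contra! hcon
  obtain ⟨z, rfl⟩ : ∃ k, z = k + 2 := Nat.exists_eq_add_of_le' (by omega)
  obtain ⟨x, rfl⟩ : ∃ k, x = k + 2 := Nat.exists_eq_add_of_le' (by omega)
  obtain ⟨m, rfl⟩ : ∃ k, m = k + 1 := Nat.exists_eq_add_of_le' hm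
  ring_nf at h
  nlinarith [Nat.zero_le (m * z), Nat.zero_le (m * x), Nat.zero_le (z * x),
    Nat.zero_le (m * x * z)]

theorem areRootsGeTwo_iff {p q a b : ℕ} :
    AreRootsGeTwo p q a b ↔ 2 ≤ a ∧ a ≤ b ∧ a + b = q + 3 ∧ a * b = p * q + 2 := by
  unfold AreRootsGeTwo
  refine and_congr_right fun _ => and_congr_right fun _ => ?_
  set P : ℤ[X] := X ^ 2 - C ((q : ℤ) + 3) * X + C ((p : ℤ) * (q : ℤ) + 2) with hP
  have hdeg : P.natDegree = 2 := by rw [hP]; compute_degree!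
  have hmonic : P.Monic := by rw [hP]; monicity!
  constructor
  · intro h
    have hprod := Polynomial.prod_multiset_X_sub_C_of_monic_of_roots_card_eq hmonic
      (by rw [h, hdeg]; rfl)
    rw [h] at hprod
    have h0 := congrArg (eval 0) hprod
    have h1 := congrArg (eval 1) hprod
    simp [hP] at h0 h1
    have hmul : (a * b : ℤ) = p * q + 2 := by linarith
    have hadd : (a + b : ℤ) = q + 3 := by linarith
    exact ⟨by exact_mod_cast hadd, by exact_mod_cast hmul⟩
  · rintro ⟨hadd, hmul⟩
    have hfac : P = (X - C (a : ℤ)) * (X - C (b : ℤ)) := by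
      rw [hP, show (q : ℤ) + 3 = a + b by exact_mod_cast hadd.symm,
        show (p : ℤ) * q + 2 = a * b by exact_mod_cast hmul.symm]
      simp only [C_add, C_mul]
      ring
    rw [hfac, roots_mul (mul_ne_zero (X_sub_C_ne_zero _) (X_sub_C_ne_zero _)), roots_X_sub_C,
      roots_X_sub_C]
    rfl

end Arithmetic

/-! ### Reversals of the path, and cospectrality of blow-ups -/

section Symmetry

variable {V W : Type*} [Fintype V] [Fintype W] {G : SimpleGraph V} {H : SimpleGraph W}
  {s t : Fin 6 → ℕ}

theorem IsBlowup.reflect (h : IsBlowup G s) : IsBlowup G ![s 1, s 0, s 3, s 2, s 4, s 5] := by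
  have hσ : ∀ i j, PathAdj i j ↔
      PathAdj ((Equiv.swap 0 1 * Equiv.swap 2 3 : Equiv.Perm (Fin 6)) i)
        ((Equiv.swap 0 1 * Equiv.swap 2 3 : Equiv.Perm (Fin 6)) j) := by decide
  convert h.relabel (Equiv.swap 0 1 * Equiv.swap 2 3) fun i j _ _ => hσ i j using 1
  funext i
  fin_cases i <;> rfl

/-- Without class `3` the path is `2 - 0 - 4 - 1`, and this is its reversal. -/
theorem IsBlowup.reflect_of_eq_zero (h : IsBlowup G s) (h3 : s 3 = 0) :
    IsBlowup G ![s 4, s 2, s 1, 0, s 0, s 5] := by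
  have hσ : ∀ i j, i ≠ 3 → j ≠ 3 → (PathAdj i j ↔
      PathAdj ((Equiv.swap 0 4 * Equiv.swap 1 2 : Equiv.Perm (Fin 6)) i)
        ((Equiv.swap 0 4 * Equiv.swap 1 2 : Equiv.Perm (Fin 6)) j)) := by decide
  convert h.relabel (Equiv.swap 0 4 * Equiv.swap 1 2) fun i j hi hj =>
    hσ i j (fun h => hi (h ▸ h3)) (fun h => hj (h ▸ h3)) using 1
  funext i
  fin_cases i <;> first | rfl | exact h3.symm

theorem IsBlowup.cospectral (hG : IsBlowup G s) (hH : IsBlowup H t)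
    (hcard : Fintype.card V = Fintype.card W)
    (he : s 0 * (s 2 + s 4) + s 1 * (s 3 + s 4) = t 0 * (t 2 + t 4) + t 1 * (t 3 + t 4))
    (hc : s 0 * s 1 * (s 2 * s 3 + s 2 * s 4 + s 3 * s 4) =
      t 0 * t 1 * (t 2 * t 3 + t 2 * t 4 + t 3 * t 4)) : Cospectral G H := by
  classical
  refine cospectral_of_charpoly_eq
    (mul_left_cancel₀ (pow_ne_zero 6 (X_ne_zero : (X : ℝ[X]) ≠ 0)) ?_)
  rw [hG.X_pow_mul_charpoly, hH.X_pow_mul_charpoly, hcard, he, hc]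

theorem IsBlowup.eq_of_cospectral (hG : IsBlowup G s) (hH : IsBlowup H t) (h : Cospectral G H) :
    s 0 * (s 2 + s 4) + s 1 * (s 3 + s 4) = t 0 * (t 2 + t 4) + t 1 * (t 3 + t 4) ∧
    s 0 * s 1 * (s 2 * s 3 + s 2 * s 4 + s 3 * s 4) =
      t 0 * t 1 * (t 2 * t 3 + t 2 * t 4 + t 3 * t 4) := by
  classical
  have hX : (X : ℝ[X]) ≠ 0 := X_ne_zero
  have key := hG.X_pow_mul_charpoly
  rw [h.charpoly_eq, hH.X_pow_mul_charpoly, h.card_eq] at key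
  have key := mul_left_cancel₀ (pow_ne_zero 2 hX) (mul_left_cancel₀ (pow_ne_zero _ hX) key)
  generalize s 0 * (s 2 + s 4) + s 1 * (s 3 + s 4) = e at *
  generalize s 0 * s 1 * (s 2 * s 3 + s 2 * s 4 + s 3 * s 4) = c at *
  generalize t 0 * (t 2 + t 4) + t 1 * (t 3 + t 4) = e' at *
  generalize t 0 * t 1 * (t 2 * t 3 + t 2 * t 4 + t 3 * t 4) = c' at *
  have h0 := congrArg (eval 0) key
  have h1 := congrArg (eval 1) key
  simp at h0 h1
  refine ⟨?_, h0.symm⟩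
  have : (e : ℝ) = e' := by
    rw [h0] at h1
    linarith
  exact_mod_cast this

end Symmetry

/-! ### The two families as blow-ups -/

section Models

theorem card_fin_val_eq_zero {n : ℕ} (hn : 1 ≤ n) : Fintype.card {i : Fin n // i.val = 0} = 1 :=
  Fintype.card_eq_one_iff.mpr ⟨⟨⟨0, hn⟩, rfl⟩, fun y => Subtype.ext (Fin.ext y.2)⟩

theorem card_fin_val_ne_zero {n : ℕ} (hn : 1 ≤ n) :
    Fintype.card {i : Fin n // ¬ i.val = 0} = n - 1 := by
  rw [Fintype.card_subtype_compl, card_fin_val_eq_zero hn, Fintype.card_fin]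

theorem card_subtype_sum {α β : Type*} [Fintype α] [Fintype β] (P : α ⊕ β → Prop)
    [DecidablePred P] : Fintype.card {c // P c} =
      Fintype.card {a // P (Sum.inl a)} + Fintype.card {b // P (Sum.inr b)} := by
  rw [Fintype.card_congr (Equiv.subtypeSum (p := P)), Fintype.card_sum]

theorem isBlowup_KPlus {p q : ℕ} (hp : 1 ≤ p) (hpq : p ≤ q) :
    IsBlowup (KPlus p q) ![q, 1, p - 1, 0, 1, 0] := by
  refine ⟨Sum.elim (Sum.elim (fun i => if i.val = 0 then 4 else 2) fun _ => 0) fun _ => 1,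
    ?_, ?_⟩
  · rintro ((i | i) | i) ((j | j) | j)
    all_goals
      simp [KPlus, IsAttachingVertex, completeBipartiteGraph, hpq, hpq.not_gt]
    all_goals
      try split_ifs
      all_goals first
        | decide
        | simp_all; done
        | simp_all; decide
  · intro i
    rw [card_subtype_sum, card_subtype_sum]
    fin_cases i <;>
      simp [ite_eq_iff, card_fin_val_eq_zero hp, card_fin_val_ne_zero hp]

/-- The ends of the deleted edge form the two end classes of the path `2 - 0 - 4 - 1`. -/
theorem isBlowup_KMinus {a b k : ℕ} (ha : 1 ≤ a) (hb : 1 ≤ b) :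
    IsBlowup (addIsolated (KMinus a b) k) ![a - 1, 1, 1, 0, b - 1, k] := by
  refine ⟨Sum.elim (Sum.elim (fun i => if i.val = 0 then 1 else 0)
    fun j => if j.val = 0 then 2 else 4) fun _ => 5, ?_, ?_⟩
  · rintro ((i | i) | i) ((j | j) | j)
    all_goals
      simp [KMinus, addIsolated, completeBipartiteGraph]
    all_goals
      try split_ifs
      all_goals first
        | decide
        | simp_all; done
        | simp_all; decide
  · intro i
    rw [card_subtype_sum, card_subtype_sum]
    fin_cases i <;>
      simp [ite_eq_iff, card_fin_val_eq_zero ha, card_fin_val_ne_zero ha,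
        card_fin_val_eq_zero hb, card_fin_val_ne_zero hb]

end Models

theorem exists_adj_KPlus {p q : ℕ} (hp : 1 ≤ p) (hpq : p ≤ q) (v : (Fin p ⊕ Fin q) ⊕ Unit) :
    ∃ w, (KPlus p q).Adj v w := by
  rcases v with (i | i) | i
  · exact ⟨Sum.inl (Sum.inr ⟨0, hp.trans hpq⟩), by simp [KPlus, completeBipartiteGraph]⟩
  · exact ⟨Sum.inl (Sum.inl ⟨0, hp⟩), by simp [KPlus, completeBipartiteGraph]⟩
  · exact ⟨Sum.inl (Sum.inl ⟨0, hp⟩), by simp [KPlus, IsAttachingVertex, hpq]⟩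

theorem isEmpty_iso_addIsolated {V W : Type*} {G : SimpleGraph V} (hG : ∀ v, ∃ w, G.Adj v w)
    (H : SimpleGraph W) {k : ℕ} (hk : 1 ≤ k) : IsEmpty (G ≃g addIsolated H k) := by
  refine ⟨fun e => ?_⟩
  obtain ⟨w, hw⟩ := hG (e.symm (Sum.inr ⟨0, hk⟩))
  have := e.map_adj_iff.mpr hw
  rw [e.apply_symm_apply] at this
  generalize e w = x at this
  cases x <;> simp [addIsolated] at this

/-! ### Solving for the class sizes -/

section Classification

variable {V : Type*} [Fintype V] {G : SimpleGraph V} {s : Fin 6 → ℕ} {p q : ℕ}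

/-- Blow-ups of a path on four vertices with the parameters of `K_{p,q}^+`. -/
theorem IsBlowup.classify_of_eq_zero (hs : IsBlowup G s) (hp : 3 ≤ p) (hpq : p ≤ q)
    (hcard : Fintype.card V = p + q + 1) (h3 : s 3 = 0)
    (he : s 0 * (s 2 + s 4) + s 1 * s 4 = p * q + 1)
    (hc : s 0 * s 1 * (s 2 * s 4) = q * (p - 1)) :
    IsBlowup G ![q, 1, p - 1, 0, 1, 0] ∨
      ∃ a b, AreRootsGeTwo p q a b ∧ IsBlowup G ![a - 1, 1, 1, 0, b - 1, p - 2] := by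
  have hsum := hs.card_eq
  obtain ⟨r, rfl⟩ : ∃ r, p = r + 3 := Nat.exists_eq_add_of_le' hp
  have hpos : 0 < s 0 * s 1 * (s 2 * s 4) := by
    rw [hc]; exact Nat.mul_pos (by omega) (by omega)
  have h0 : 1 ≤ s 0 := Nat.pos_of_ne_zero fun h => by simp [h] at hpos
  have h1 : 1 ≤ s 1 := Nat.pos_of_ne_zero fun h => by simp [h] at hpos
  have h2 : 1 ≤ s 2 := Nat.pos_of_ne_zero fun h => by simp [h] at hpos
  have h4 : 1 ≤ s 4 := Nat.pos_of_ne_zero fun h => by simp [h] at hpos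
  -- The gap `q + 1` is at least 4, enough for both inequalities on the four-vertex path.
  have hdiff : s 0 * (s 2 + s 4) + s 1 * s 4 = s 0 * s 1 * (s 2 * s 4) + q + 1 := by
    rw [he, hc, show r + 3 - 1 = r + 2 by omega]
    ring
  rw [show r + 3 - 1 = r + 2 by omega] at hc ⊢
  -- the reflection of the path on four vertices reduces to the case where the class `1` is a
  -- single vertex
  have main : ∀ t : Fin 6 → ℕ, IsBlowup G t → t 3 = 0 → 1 ≤ t 0 → 1 ≤ t 2 → 1 ≤ t 4 →
      t 1 = 1 → t 0 * (t 2 + t 4) + t 4 = t 0 * (t 2 * t 4) + q + 1 →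
      t 0 * (t 2 * t 4) = q * (r + 2) → IsBlowup G ![q, 1, r + 2, 0, 1, 0] ∨
      ∃ a b, AreRootsGeTwo (r + 3) q a b ∧ IsBlowup G ![a - 1, 1, 1, 0, b - 1, r + 3 - 2] := by
    intro t ht t3 t0 t2 t4 t1 hd hc
    have hsum := ht.card_eq
    rcases eq_one_or_eq_one_of_two_lt t0 t2 t4 (by omega) with hz | hx
    · left
      rw [hz] at hd hc hsum
      have ht0 : t 0 = q := by
        rw [mul_add, mul_one, mul_one] at hd
        omega
      have ht2 : t 2 = r + 2 := by
        rw [ht0, mul_one] at hc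
        exact Nat.eq_of_mul_eq_mul_left (by omega) hc
      convert ht using 1
      funext i
      fin_cases i
      exacts [ht0.symm, t1.symm, ht2.symm, t3.symm, hz.symm, by simp; omega]
    · right
      rw [hx] at hd hc hsum
      have hadd : t 0 + t 4 = q + 1 := by
        rw [mul_add, mul_one, one_mul] at hd
        omega
      have ht5 : t 5 = r + 1 := by omega
      have hmul : (t 0 + 1) * (t 4 + 1) = (r + 3) * q + 2 := by
        rw [one_mul] at hc
        linear_combination hc + hadd
      -- The roots are `t 0 + 1` and `t 4 + 1`; reversing the path puts them in increasing order.
      rcases le_total (t 0) (t 4) with hle | hle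
      · refine ⟨t 0 + 1, t 4 + 1, areRootsGeTwo_iff.mpr
          ⟨by omega, by omega, by omega, hmul⟩, ?_⟩
        convert ht using 1
        funext i
        fin_cases i
        exacts [rfl, t1.symm, hx.symm, t3.symm, rfl, ht5.symm]
      · refine ⟨t 4 + 1, t 0 + 1, areRootsGeTwo_iff.mpr
          ⟨by omega, by omega, by omega, by rw [mul_comm, hmul]⟩, ?_⟩
        convert ht.reflect_of_eq_zero t3 using 1
        funext i
        fin_cases i
        exacts [rfl, hx.symm, t1.symm, rfl, rfl, ht5.symm]
  rcases eq_one_or_eq_one_of_lt h0 h1 h2 h4 (by omega) with hn | hx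
  · exact main s hs h3 h0 h2 h4 hn (by simpa [hn] using hdiff) (by simpa [hn] using hc)
  · refine main _ (hs.reflect_of_eq_zero h3) rfl h4 h1 h0 hx ?_ ?_
    · simp only [hx] at hdiff
      show s 4 * (s 1 + s 0) + s 0 = s 4 * (s 1 * s 0) + q + 1
      linear_combination hdiff
    · simp only [hx] at hc
      show s 4 * (s 1 * s 0) = q * (r + 2)
      linear_combination hc

theorem IsBlowup.classify (hs : IsBlowup G s) (hp : 3 ≤ p) (hpq : p ≤ q)
    (hcard : Fintype.card V = p + q + 1)
    (he : s 0 * (s 2 + s 4) + s 1 * (s 3 + s 4) = p * q + 1)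
    (hc : s 0 * s 1 * (s 2 * s 3 + s 2 * s 4 + s 3 * s 4) = q * (p - 1)) :
    IsBlowup G ![q, 1, p - 1, 0, 1, 0] ∨
      ∃ a b, AreRootsGeTwo p q a b ∧ IsBlowup G ![a - 1, 1, 1, 0, b - 1, p - 2] := by
  have hpos : 0 < s 0 * s 1 * (s 2 * s 3 + s 2 * s 4 + s 3 * s 4) := by
    rw [hc]; exact Nat.mul_pos (by omega) (by omega)
  have h0 : 1 ≤ s 0 := Nat.pos_of_ne_zero fun h => by simp [h] at hpos
  have h1 : 1 ≤ s 1 := Nat.pos_of_ne_zero fun h => by simp [h] at hpos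
  have hdiff : s 0 * s 1 * (s 2 * s 3 + s 2 * s 4 + s 3 * s 4) + 1 <
      s 0 * (s 2 + s 4) + s 1 * (s 3 + s 4) := by
    obtain ⟨r, rfl⟩ : ∃ r, p = r + 3 := Nat.exists_eq_add_of_le' hp
    rw [he, hc, show r + 3 - 1 = r + 2 by omega]
    nlinarith
  rcases eq_zero_or_eq_zero_of_lt h0 h1 hdiff with h | h
  · refine hs.reflect.classify_of_eq_zero hp hpq hcard h ?_ ?_
    · show s 1 * (s 3 + s 4) + s 0 * s 4 = _
      rw [← he, h]
      ring
    · show s 1 * s 0 * (s 3 * s 4) = _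
      rw [← hc, h]
      ring
  · refine hs.classify_of_eq_zero hp hpq hcard h ?_ ?_
    · rw [← he, h, zero_add]
    · rw [← hc, h]
      ring

theorem isBlowup_of_cospectral_KPlus (hp : 3 ≤ p) (hpq : p ≤ q) (h : Cospectral (KPlus p q) G) :
    IsBlowup G ![q, 1, p - 1, 0, 1, 0] ∨
      ∃ a b, AreRootsGeTwo p q a b ∧ IsBlowup G ![a - 1, 1, 1, 0, b - 1, p - 2] := by
  classical
  have hK := isBlowup_KPlus (by omega : 1 ≤ p) hpq
  have hcard := h.card_eq
  obtain ⟨s, hs⟩ := exists_isBlowup (h.colorable_two hK.colorable) (h.rank_eq ▸ hK.rank_lt)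
  obtain ⟨he, hc⟩ := hK.eq_of_cospectral hs h
  obtain ⟨r, rfl⟩ : ∃ r, p = r + 3 := Nat.exists_eq_add_of_le' hp
  refine hs.classify hp hpq ?_ (he.symm.trans ?_) (hc.symm.trans ?_)
  · rw [← hcard]
    simp
  · simp
    ring
  · simp

theorem cospectral_KPlus_of_areRoots (hp : 3 ≤ p) (hpq : p ≤ q) {a b : ℕ}
    (h : AreRootsGeTwo p q a b) :
    Cospectral (KPlus p q) (addIsolated (KMinus a b) (p - 2)) := by
  obtain ⟨ha, hab, hadd, hmul⟩ := areRootsGeTwo_iff.mp h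
  obtain ⟨r, rfl⟩ : ∃ r, p = r + 3 := Nat.exists_eq_add_of_le' hp
  obtain ⟨a, rfl⟩ : ∃ c, a = c + 1 := Nat.exists_eq_add_of_le' (by omega)
  obtain ⟨b, rfl⟩ : ∃ c, b = c + 1 := Nat.exists_eq_add_of_le' (by omega)
  refine (isBlowup_KPlus (by omega) hpq).cospectral (isBlowup_KMinus (by omega) (by omega)) ?_ ?_ ?_
  · simp
    omega
  · simp
    linear_combination -hmul
  · simp
    linear_combination hadd - hmul

end Classification

end NearlyCompleteBipartite

theorem theorem4p1 (p q : ℕ) (hp : 3 ≤ p) (hpq : p ≤ q) :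
    (¬ NearlyCompleteBipartite.IsDS (NearlyCompleteBipartite.KPlus p q) ↔
      ∃ a b : ℕ, NearlyCompleteBipartite.AreRootsGeTwo p q a b) ∧
    (∀ a b : ℕ, NearlyCompleteBipartite.AreRootsGeTwo p q a b →
      NearlyCompleteBipartite.IsUniqueCospectralMate
        (NearlyCompleteBipartite.KPlus p q)
        (NearlyCompleteBipartite.addIsolated (NearlyCompleteBipartite.KMinus a b) (p - 2))) := by
  have hK := NearlyCompleteBipartite.isBlowup_KPlus (by omega : 1 ≤ p) hpq
  have hiso : ∀ a b, IsEmpty (NearlyCompleteBipartite.KPlus p q ≃g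
      NearlyCompleteBipartite.addIsolated (NearlyCompleteBipartite.KMinus a b) (p - 2)) :=
    fun a b => NearlyCompleteBipartite.isEmpty_iso_addIsolated
      (NearlyCompleteBipartite.exists_adj_KPlus (by omega) hpq) _ (by omega)
  refine ⟨⟨fun h => ?_, fun ⟨a, b, h⟩ hDS => ?_⟩, fun a b h =>
    ⟨NearlyCompleteBipartite.cospectral_KPlus_of_areRoots hp hpq h, hiso a b, fun U _ F hF hne => ?_⟩⟩
  · by_contra hno
    refine h fun W _ H hH => ?_
    rcases NearlyCompleteBipartite.isBlowup_of_cospectral_KPlus hp hpq hH with hB | ⟨a, b, hab, -⟩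
    · exact hK.nonempty_iso hB
    · exact absurd ⟨a, b, hab⟩ hno
  · obtain ⟨e⟩ := hDS _ _ (NearlyCompleteBipartite.cospectral_KPlus_of_areRoots hp hpq h)
    exact (hiso a b).false e
  · rcases NearlyCompleteBipartite.isBlowup_of_cospectral_KPlus hp hpq hF with hB | ⟨c, d, hcd, hB⟩
    · exact (hne.false (hK.nonempty_iso hB).some).elim
    · obtain ⟨ha, hab, hadd, hmul⟩ := NearlyCompleteBipartite.areRootsGeTwo_iff.mp h
      obtain ⟨hc, hcd, hadd', hmul'⟩ := NearlyCompleteBipartite.areRootsGeTwo_iff.mp hcd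
      have hac : a = c := by
        -- The squared difference of the roots is the discriminant, so both ordered pairs have the
        -- same difference and the same sum.
        obtain ⟨k, rfl⟩ := Nat.exists_eq_add_of_le hab
        obtain ⟨l, rfl⟩ := Nat.exists_eq_add_of_le hcd
        have hsum : 2 * a + k = 2 * c + l := by omega
        have hkl : k ^ 2 = l ^ 2 := by
          zify at hsum hmul hmul' ⊢
          linear_combination (2 * (a : ℤ) + k + (2 * c + l)) * hsum - 4 * (hmul - hmul')
        have := Nat.pow_left_injective two_ne_zero hkl
        omega
      obtain rfl := hac
      obtain rfl : b = d := by omega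
      exact hB.nonempty_iso (NearlyCompleteBipartite.isBlowup_KMinus (by omega) (by omega))
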